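/- (Local double loop lemma.) Let $\mathbf A=(A;t^{\mathbf A})$ and $\mathbf B=(B;t^{\mathbf B})$ be algebras in the signature consisting of a single $n$-ary operation symbol $t$. Assume that $\mathbf A$ is generated by $\{x^{\mathbf A},y^{\mathbf A}\}$, that $t^{\mathbf A}$ is idempotent, i.e. $t^{\mathbf A}(a,\dots,a)=a$ for all $a\in A$, that $\mathbf B$ is generated by $\{x^{\mathbf B},y^{\mathbf B}\}$, and that $t^{\mathbf B}$ satisfies some quasi Taylor system of equations locally on $\{x^{\mathbf B},y^{\mathbf B}\}$. Here a quasi Taylor system of equations consists of $n$ equations, one for each position $i\in\{0,\dots,n-1\}$, of the form $$t(z_{i,0},\dots,z_{i,n-1})\approx t(w_{i,0},\dots,w_{i,n-1}),$$ where all $z_{i,j},w_{i,j}$ are variables from $\{x,y\}$, $z_{i,i}$ is $x$ and $w_{i,i}$ is $y$; it is satisfied by $t^{\mathbf B}$ locally on $X\subseteq B$ if each of its equations holds in $\mathbf B$ whenever the values of the variables $x,y$ are chosen from $X$. Let $Q$ be the subuniverse of $\mathbf A^2\times\mathbf B^2$ generated by the 12 quadruples $[a_0^{\mathbf A},a_1^{\mathbf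 A},b_0^{\mathbf B},b_1^{\mathbf B}]$, where $a_0,a_1,b_0,b_1$ are symbols from $\{x,y\}$ such that $a_0\neq a_1$ or $b_0\neq b_1$ as symbols (this reading of the inequalities matters only if $x^{\mathbf A}=y^{\mathbf A}$ or $x^{\mathbf B}=y^{\mathbf B}$). Then $Q$ contains a double loop, that is, there are $a\in A$ and $b\in B$ with $[a,a,b,b]\in Q$. -/

import Mathlib

/-- The two variables occurring in a (quasi) Taylor system of equations. -/
inductive TaylorVar : Type
  | x
  | y

/-- The substitution of `a` for the variable `x` and of `b` for the variable `y`. -/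
def TaylorVar.subst {A : Type*} (a b : A) : TaylorVar → A
  | TaylorVar.x => a
  | TaylorVar.y => b

/-- An `n`-ary operation `t` is idempotent if `t (a, …, a) = a` for every `a`. -/
def IsIdempotentOperation {A : Type*} {n : ℕ} (t : (Fin n → A) → A) : Prop :=
  ∀ a : A, t (fun _ => a) = a

/-- A subuniverse of the algebra `(A; t)`: a subset closed under `t`. -/
def IsSubuniverse {A : Type*} {n : ℕ} (t : (Fin n → A) → A) (S : Set A) : Prop :=
  ∀ a : Fin n → A, (∀ i, a i ∈ S) → t a ∈ S

/-- The subuniverse of `(A; t)` generated by `X`: the smallest subuniverse containing `X`. -/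
def generatedSubuniverse {A : Type*} {n : ℕ} (t : (Fin n → A) → A) (X : Set A) : Set A :=
  ⋂₀ {S : Set A | X ⊆ S ∧ IsSubuniverse t S}

/-- The algebra `(A; t)` is generated by `X`. -/
def IsGeneratedBy {A : Type*} {n : ℕ} (t : (Fin n → A) → A) (X : Set A) : Prop :=
  generatedSubuniverse t X = Set.univ

/-- The basic operation of the algebra `𝐀² × 𝐁²`, acting coordinatewise on quadruples
`[a₀, a₁, b₀, b₁]`. -/
def quadrupleOperation {A B : Type*} {n : ℕ} (tA : (Fin n → A) → A) (tB : (Fin n → B) → B)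
    (q : Fin n → A × A × B × B) : A × A × B × B :=
  (tA (fun i => (q i).1), tA (fun i => (q i).2.1),
    tB (fun i => (q i).2.2.1), tB (fun i => (q i).2.2.2))

/-- A quasi Taylor system of equations for an `n`-ary symbol `t`. It consists of `n` equations;
the equation number `i` is `t (lhs i 0, …, lhs i (n-1)) ≈ t (rhs i 0, …, rhs i (n-1))`, with the
variable `x` at position `i` on the left, the variable `y` at position `i` on the right, and
arbitrary choices of `x` or `y` at all the other positions. -/
structure QuasiTaylorSystem (n : ℕ) where
  lhs : Fin n → Fin n → TaylorVar
  rhs : Fin n → Fin n → TaylorVar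
  lhs_diag : ∀ i, lhs i i = TaylorVar.x
  rhs_diag : ∀ i, rhs i i = TaylorVar.y

/-- The operation `t` satisfies the system `T` locally on `X`: every equation of `T` holds
whenever the values of the variables are chosen from `X`. -/
def QuasiTaylorSystem.SatisfiedLocallyOn {B : Type*} {n : ℕ} (T : QuasiTaylorSystem n)
    (t : (Fin n → B) → B) (X : Set B) : Prop :=
  ∀ i : Fin n, ∀ u ∈ X, ∀ v ∈ X,
    t (fun j => (T.lhs i j).subst u v) = t (fun j => (T.rhs i j).subst u v)

/-- The 12 quadruples `[a₀, a₁, b₀, b₁]` over `{x, y}` with `a₀ ≠ a₁` or `b₀ ≠ b₁`, where `x`, `y`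
are evaluated as `xA`, `yA` in the first two coordinates and as `xB`, `yB` in the last two. -/
def doubleLoopGenerators {A B : Type*} (xA yA : A) (xB yB : B) : Set (A × A × B × B) :=
  {q | ∃ a₀ a₁ b₀ b₁ : TaylorVar, (a₀ ≠ a₁ ∨ b₀ ≠ b₁) ∧
    q = (a₀.subst xA yA, a₁.subst xA yA, b₀.subst xB yB, b₁.subst xB yB)}

/-! Let `E a₀ a₁` mean that `[a₀, a₁, b, b]` lies in `Q` for some `b`; the goal is a loop of `E`.
This relation is symmetric, compatible with `t` and contains the edge from `x` to `y`. By the `i`-th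
quasi Taylor equation, it relates `t f` to `t g` whenever the `x`/`y`-labellings `f`, `g` differ
everywhere except possibly at position `i`. Applying such flips once for each `i` changes every
position `n - 1` times, which yields an odd closed walk at `x` (`exists_odd_closed_walk`).

Odd closed walks are then shortened by two at a time (`exists_loop_of_odd_closed_walk`). A closed
walk of length `2m + 3` at `u` is a triangle for the relation `F` of being joined by a walk of
length `2m + 1`, and idempotence and generation give a path `x, y, …, u`. A path with a triangle at
its end forces an `F`-loop (`exists_loop_of_triangle`): label the nodes of the `n`-ary tree by its
vertices so that each label is `F`-related to `t` of the labels of the children, and so that labels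
of deep nodes depend only on the last `K` letters of their addresses. By idempotence the trees of
depth `K` and `K + 1` then have the same value, which is `F`-related to itself.

The labels are states of an automaton walking along the graph. The triangle leaves enough freedom
for its state to forget the distant past. The sole obstacle is a long constant run, where the walk
parks at `x`; there the edge from `x` to `t(y, …, x, …, y)`, again a flip, takes over. -/

/-- The length of the longest constant initial segment of a list. -/
def runLength {n : ℕ} : List (Fin n) → ℕ
  | [] => 0
  | [_] => 1
  | a :: b :: l => if a = b then runLength (b :: l) + 1 else 1

/-- The head of the list is larger than the letter following it. -/
def IsAscent {n : ℕ} : List (Fin n) → Prop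
  | a :: b :: _ => b < a
  | _ => False

open Classical in
/-- The state of the colouring automaton after reading a word, the last read letter being the head
of the list. The states `0, …, s` are the vertices of a path, and `s`, `s + 1`, `s + 2` form a
triangle. -/
noncomputable def colourState {n : ℕ} (s : ℕ) : List (Fin n) → ℕ
  | [] => s
  | a :: l =>
    if runLength (a :: l) = s + 2 then s + 2
    else if s + 2 < runLength (a :: l) then
      (if colourState s l ≤ s then colourState s l - 1 else s)
    else if colourState s l < s then colourState s l + 1
    else if colourState s l = s + 2 then s
    else if IsAscent (a :: l) then s + 2
    else if colourState s l = s then s + 1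
    else s

/-! ### Transitions of the colouring automaton -/

section Automaton

variable {n s : ℕ}

theorem runLength_cons_eq (a : Fin n) (l : List (Fin n)) :
    runLength (a :: l) = 1 ∨
      (runLength (a :: l) = runLength l + 1 ∧ ¬ IsAscent (a :: l) ∧ l.head? = some a) := by
  cases l with
  | nil => simp [runLength]
  | cons b l =>
    by_cases h : a = b
    · subst h; right; simp [runLength, IsAscent]
    · left; simp [runLength, h]

theorem runLength_le_length (l : List (Fin n)) : runLength l ≤ l.length := by
  induction l with
  | nil => simp [runLength]
  | cons a l ih =>
    have := runLength_cons_eq a l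
    simp only [List.length_cons]
    omega

theorem runLength_append (l : List (Fin n)) (i : Fin n) :
    runLength l ≤ runLength (l ++ [i]) ∧
      (runLength l < l.length → runLength (l ++ [i]) = runLength l) := by
  induction l with
  | nil => simp [runLength]
  | cons a l ih =>
    cases l with
    | nil =>
      by_cases h : a = i <;> simp [runLength, h]
    | cons b l =>
      simp only [List.cons_append, runLength, List.length_cons] at ih ⊢
      by_cases h : a = b
      · simp only [h, if_true]
        exact ⟨by omega, fun h' => by rw [ih.2 (by omega)]⟩
      · simp [h]

theorem isAscent_append {l : List (Fin n)} (h : 2 ≤ l.length) (i : Fin n) :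
    IsAscent (l ++ [i]) ↔ IsAscent l := by
  match l, h with
  | a :: b :: l, _ => simp [IsAscent]

theorem not_isAscent_of_two_le_runLength {l : List (Fin n)} (h : 2 ≤ runLength l) :
    ¬ IsAscent l := by
  cases l with
  | nil => simp [IsAscent]
  | cons a l =>
    rcases runLength_cons_eq a l with h' | h'
    · omega
    · exact h'.2.1

theorem colourState_le (l : List (Fin n)) : colourState s l ≤ s + 2 := by
  induction l with
  | nil => simp [colourState]
  | cons a l ih =>
    rw [colourState]
    split_ifs <;> omega

/-- A run of length `s + 2` resets the automaton. As the run continues, the states are `s + 2, s, s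
- 1, …, 0`, and truncated subtraction keeps the state at `0` afterwards. -/
theorem colourState_of_run (l : List (Fin n)) (h : s + 2 ≤ runLength l) :
    colourState s l =
      if runLength l = s + 2 then s + 2 else s + 1 + (s + 2) - runLength l := by
  induction l with
  | nil => simp [runLength] at h
  | cons a l ih =>
    rw [colourState]
    rcases runLength_cons_eq a l with h' | h'
    · omega
    · by_cases h1 : runLength (a :: l) = s + 2
      · simp [h1]
      · have h2 := ih (by omega)
        rw [if_neg h1, if_pos (by omega), if_neg h1, h2]
        split_ifs <;> omega

theorem min_le_colourState_cons (a : Fin n) (l : List (Fin n))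
    (h : runLength (a :: l) ≤ s + 2) :
    min s (colourState s l + 1) ≤ colourState s (a :: l) := by
  rw [colourState]
  split_ifs <;> omega

theorem min_le_colourState (l : List (Fin n)) (h : runLength l ≤ s + 2) :
    min s (runLength l - 1) ≤ colourState s l := by
  induction l with
  | nil => simp [runLength]
  | cons a l ih =>
    have h1 := min_le_colourState_cons a l h
    rcases runLength_cons_eq a l with h' | h'
    · omega
    · have := ih (by omega)
      omega

theorem run_or_ascent_of_colourState {l : List (Fin n)} (h : colourState s l = s + 2) :
    runLength l = s + 2 ∨ IsAscent l := by
  cases l with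
  | nil => simp [colourState] at h
  | cons a l =>
    rw [colourState] at h
    split_ifs at h <;> first | omega | tauto

/-- Adjacency of the states in the graph consisting of the path and the triangle. -/
def ColourAdj (s c d : ℕ) : Prop :=
  (c + 1 = d ∧ d ≤ s) ∨ (d + 1 = c ∧ c ≤ s) ∨
    (s ≤ c ∧ s ≤ d ∧ c ≤ s + 2 ∧ d ≤ s + 2 ∧ c ≠ d)

/-- The delicate transition is the reset. Just before it the run has length `s + 1`, so the state
has climbed to at least `s`. It is not `s + 2`, since this would need an ascent or a run of length
`s + 2`; here `1 ≤ s` matters, as a run of length at least `2` excludes an ascent. Hence the jump to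
`s + 2` is an edge. -/
theorem colourAdj_or_zero (hs : 1 ≤ s) (a : Fin n) (l : List (Fin n)) :
    ColourAdj s (colourState s l) (colourState s (a :: l)) ∨
      (colourState s l = 0 ∧ colourState s (a :: l) = 0 ∧ l.head? = some a) := by
  have hle := colourState_le (s := s) l
  have hrun := runLength_cons_eq a l
  have h2 := @run_or_ascent_of_colourState n s l
  have h3 := min_le_colourState (s := s) l
  have h4 := @not_isAscent_of_two_le_runLength n l
  by_cases hR : runLength (a :: l) = s + 2
  · have e : colourState s (a :: l) = s + 2 := by rw [colourState]; simp [hR]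
    rcases hrun with h | h
    · omega
    · left
      have : colourState s l ≠ s + 2 := fun hc => by
        rcases h2 hc with h5 | h5
        · omega
        · exact h4 (by omega) h5
      have := h3 (by omega)
      rw [e]; unfold ColourAdj; omega
  · by_cases hR' : s + 2 < runLength (a :: l)
    · have e : colourState s (a :: l) =
          if colourState s l ≤ s then colourState s l - 1 else s := by
        rw [colourState]; simp [hR, hR']
      rcases hrun with h | h
      · omega
      · rw [e]
        by_cases h0 : colourState s l = 0
        · right; simp [h0, h.2.2]
        · left; unfold ColourAdj; split_ifs <;> omega
    · left
      rw [colourState, if_neg hR, if_neg hR']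
      unfold ColourAdj
      split_ifs <;> omega

/-! ### Synchronization: the state forgets the distant past -/

/-- An older letter changes the run length only if the run fills the whole word; a run of length at
least `2 * s + 4` has already descended to state `0`. -/
theorem colourState_append_eq_or (l : List (Fin n)) (i : Fin n) (hl : 2 * s + 4 ≤ l.length) :
    runLength (l ++ [i]) = runLength l ∨ colourState s (l ++ [i]) = colourState s l := by
  have h := runLength_append l i
  have h' := runLength_le_length l
  by_cases hlt : runLength l < l.length
  · exact Or.inl (h.2 hlt)
  · right
    rw [colourState_of_run l (by omega), colourState_of_run _ (by omega),
      if_neg (by omega), if_neg (by omega)]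
    omega

/-- The state still depends on the letter preceding the word. -/
def Unsynced (s : ℕ) (i : Fin n) (l : List (Fin n)) : Prop :=
  2 * s + 4 ≤ l.length ∧ colourState s (l ++ [i]) ≠ colourState s l

theorem Unsynced.runLength_lt {i : Fin n} {l : List (Fin n)} (h : Unsynced s i l) :
    runLength (l ++ [i]) = runLength l ∧ runLength l < s + 2 := by
  have h1 := (colourState_append_eq_or l i h.1).resolve_right h.2
  refine ⟨h1, ?_⟩
  by_contra! h2
  apply h.2
  rw [colourState_of_run l h2, colourState_of_run _ (by omega), h1]

/-- Two computations in the same state stay together, because the added letter gives both the same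
run length and the same ascent status. -/
theorem Unsynced.of_cons {i a : Fin n} {l : List (Fin n)} (h : Unsynced s i (a :: l))
    (hl : 2 * s + 4 ≤ l.length) : Unsynced s i l := by
  refine ⟨hl, fun he => h.2 ?_⟩
  have h1 := h.runLength_lt.1
  have h2 := isAscent_append (l := a :: l) (by simp; omega) i
  rw [List.cons_append] at h1 h2 ⊢
  rw [colourState, colourState, he, h1]
  by_cases ha : IsAscent (a :: l)
  · rw [if_pos ha, if_pos (h2.2 ha)]
  · rw [if_neg ha, if_neg (mt h2.1 ha)]

/-- While the states disagree, no run has reached `s + 2`, so there is no descent and both states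
climb to level `s`. -/
theorem Unsynced.min_le {i : Fin n} {p l : List (Fin n)} (h : Unsynced s i (p ++ l))
    (hl : 2 * s + 4 ≤ l.length) :
    min s p.length ≤ colourState s (p ++ l) ∧
      min s p.length ≤ colourState s (p ++ l ++ [i]) := by
  induction p with
  | nil => simp
  | cons a p ih =>
    rw [List.cons_append] at h ⊢
    have h1 := ih (h.of_cons (by simp; omega))
    have h2 := h.runLength_lt
    have h3 := min_le_colourState_cons (s := s) a (p ++ l) (by simpa using h2.2.le)
    have h4 := min_le_colourState_cons (s := s) a (p ++ l ++ [i]) (by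
      rw [List.cons_append] at h2
      omega)
    rw [List.cons_append, List.length_cons]
    omega

open Classical in
/-- A quantity that decreases as long as the state is not determined. -/
noncomputable def syncPotential (s : ℕ) : List (Fin n) → ℕ
  | [] => 0
  | a :: l => if IsAscent (a :: l) then n * (s + 2) + (s + 2) + (n - a.val)
    else a.val * (s + 2) + (s + 2 - runLength (a :: l))

theorem syncPotential_le (l : List (Fin n)) :
    syncPotential s l ≤ n * (s + 2) + (s + 2) + n := by
  cases l with
  | nil => simp [syncPotential]
  | cons a l =>
    have : a.val * (s + 2) ≤ n * (s + 2) := Nat.mul_le_mul_right _ a.isLt.le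
    simp only [syncPotential]
    split_ifs <;> omega

/-- Without synchronization, the letters can only increase strictly at first and then decrease
weakly, in runs shorter than `s + 2`; the potential measures progress along this pattern. -/
theorem Unsynced.syncPotential_lt {i a : Fin n} {l : List (Fin n)} (h : Unsynced s i (a :: l))
    (hl : 2 * s + 4 ≤ l.length) (h1 : s ≤ colourState s l) (h2 : s ≤ colourState s (l ++ [i])) :
    syncPotential s (a :: l) < syncPotential s l := by
  have hU := h.of_cons hl
  have hR := h.runLength_lt
  have hR' := hU.runLength_lt
  have hasc := isAscent_append (l := l) (by omega) i
  have hasc' := isAscent_append (l := a :: l) (by simp; omega) i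
  -- An ascent after a non-ascent finds neither state at `s + 2`, hence sends both there and
  -- synchronizes them.
  have key : IsAscent (a :: l) → IsAscent l := by
    intro ha
    by_contra hna
    have e1 : colourState s l ≠ s + 2 := fun hc => by
      rcases run_or_ascent_of_colourState hc with h5 | h5
      · omega
      · exact hna h5
    have e2 : colourState s (l ++ [i]) ≠ s + 2 := fun hc => by
      rcases run_or_ascent_of_colourState hc with h5 | h5
      · omega
      · exact hna (hasc.1 h5)
    apply h.2
    rw [List.cons_append] at hR hasc' ⊢
    have ha' := hasc'.2 ha
    rw [colourState, colourState]
    rw [if_neg (by omega), if_neg (by omega), if_neg (by omega), if_neg e2, if_pos ha',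
      if_neg (by omega), if_neg (by omega), if_neg (by omega), if_neg e1, if_pos ha]
  match l, hl with
  | b :: l, _ =>
    have hb := b.isLt
    have ha := a.isLt
    have hbm : (b.val + 1) * (s + 2) ≤ n * (s + 2) := Nat.mul_le_mul_right _ hb
    have ham : (a.val + 1) * (s + 2) ≤ n * (s + 2) := Nat.mul_le_mul_right _ ha
    rw [Nat.add_mul] at hbm ham
    have hrun := runLength_cons_eq a (b :: l)
    simp only [syncPotential]
    by_cases h3 : IsAscent (a :: b :: l)
    · have h4 : b.val < a.val := h3
      rw [if_pos h3, if_pos (key h3)]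
      omega
    · rw [if_neg h3]
      by_cases h5 : IsAscent (b :: l)
      · rw [if_pos h5]; omega
      · rw [if_neg h5]
        have h4 : a ≤ b := not_lt.1 h3
        rcases h4.eq_or_lt with h6 | h6
        · subst h6
          have : runLength (a :: a :: l) = runLength (a :: l) + 1 := by simp [runLength]
          omega
        · have h7 : a.val + 1 ≤ b.val := h6
          have h8 : (a.val + 1) * (s + 2) ≤ b.val * (s + 2) := Nat.mul_le_mul_right _ h7
          rw [Nat.add_mul] at h8
          have : runLength (a :: b :: l) = 1 := by simp [runLength, h6.ne]
          omega

theorem Unsynced.length_le {i : Fin n} {p q l : List (Fin n)}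
    (h : Unsynced s i (p ++ (q ++ l))) (hl : 2 * s + 4 ≤ l.length) (hq : s ≤ q.length) :
    p.length + syncPotential s (p ++ (q ++ l)) ≤ syncPotential s (q ++ l) := by
  induction p with
  | nil => simp
  | cons a p ih =>
    rw [List.cons_append] at h ⊢
    have hU := h.of_cons (by simp; omega)
    have h1 := ih hU
    have h2 := Unsynced.min_le (p := p ++ q) (l := l) (by simpa using hU) hl
    simp only [List.length_append, List.append_assoc] at h2
    have h3 := Unsynced.syncPotential_lt h (by simp; omega) (by omega)
      (by simp only [List.append_assoc]; omega)
    rw [List.length_cons]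
    omega

theorem exists_colourState_append_eq (n s : ℕ) :
    ∃ K, ∀ l : List (Fin n), K ≤ l.length → ∀ i,
      colourState s (l ++ [i]) = colourState s l := by
  set N := n * (s + 2) + (s + 2) + n + 1 with hN
  -- From the oldest letters on: `2 * s + 4` make the run lengths reliable, `s` let both states
  -- climb, and `N` exceeds the maximum of the potential.
  refine ⟨N + (s + (2 * s + 4)), fun l hl i => ?_⟩
  by_contra hne
  have e : l = l.take N ++ ((l.drop N).take s ++ (l.drop N).drop s) := by simp
  have hU : Unsynced s i l := ⟨by omega, hne⟩
  rw [e] at hU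
  have h1 := hU.length_le (by simp; omega) (by simp; omega)
  have h2 := syncPotential_le (s := s) ((l.drop N).take s ++ (l.drop N).drop s)
  simp only [List.length_take] at h1
  omega

end Automaton

/-! ### Walks in compatible digraphs -/

/-- There is a walk of length `k` from `a` to `b` in the digraph `E`. -/
def IsWalk {A : Type*} (E : A → A → Prop) : ℕ → A → A → Prop
  | 0, a, b => a = b
  | k + 1, a, b => ∃ c, E a c ∧ IsWalk E k c b

/-- The relation `E` is compatible with the operation `t`. -/
def IsCompatible {A : Type*} {n : ℕ} (t : (Fin n → A) → A) (E : A → A → Prop) : Prop :=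
  ∀ u v : Fin n → A, (∀ i, E (u i) (v i)) → E (t u) (t v)

/-- The value of the complete tree of depth `k` over the operation `t`, with leaves labelled by `f`.
A leaf is given by the path leading to it, listed from the leaf to the root. -/
def treeValue {A : Type*} {n : ℕ} (t : (Fin n → A) → A) : ℕ → (List (Fin n) → A) → A
  | 0, f => f []
  | k + 1, f => treeValue t k (fun l => t (fun j => f (j :: l)))

section Walks

variable {A : Type*} {E : A → A → Prop}

theorem IsWalk.append {k m : ℕ} {a b c : A} (h : IsWalk E k a b) (h' : IsWalk E m b c) :
    IsWalk E (k + m) a c := by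
  induction k generalizing a with
  | zero => cases h; simpa using h'
  | succ k ih =>
    obtain ⟨d, hd, hw⟩ := h
    rw [Nat.add_right_comm]
    exact ⟨d, hd, ih hw⟩

theorem isWalk_one {a b : A} (h : E a b) : IsWalk E 1 a b := ⟨b, h, rfl⟩

theorem IsWalk.reverse (hE : ∀ ⦃a b⦄, E a b → E b a) {k : ℕ} {a b : A} (h : IsWalk E k a b) :
    IsWalk E k b a := by
  induction k generalizing a with
  | zero => exact Eq.symm h
  | succ k ih =>
    obtain ⟨d, hd, hw⟩ := h
    exact (ih hw).append (isWalk_one (hE hd))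

theorem isWalk_bounce (hE : ∀ ⦃a b⦄, E a b → E b a) {a b : A} (h : E a b) (k : ℕ) :
    IsWalk E (2 * k) a a := by
  induction k with
  | zero => rfl
  | succ k ih => exact ⟨b, h, a, hE h, ih⟩

theorem isWalk_of_edge (hE : ∀ ⦃a b⦄, E a b → E b a) {a b : A} (h : E a b) (k : ℕ) :
    IsWalk E (2 * k + 1) a b :=
  (isWalk_bounce hE h k).append (isWalk_one h)

theorem IsWalk.exists_vertices {k : ℕ} {a b : A} (h : IsWalk E k a b) :
    ∃ r : ℕ → A, r 0 = a ∧ r k = b ∧ ∀ i < k, E (r i) (r (i + 1)) := by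
  induction k generalizing a with
  | zero => exact ⟨fun _ => a, rfl, h, by simp⟩
  | succ k ih =>
    obtain ⟨d, hd, hw⟩ := h
    obtain ⟨r, h0, hk, hr⟩ := ih hw
    refine ⟨fun i => Nat.casesOn i a r, rfl, hk, fun i hi => ?_⟩
    cases i with
    | zero => simpa [h0] using hd
    | succ i => exact hr i (by omega)

variable {n : ℕ} {t : (Fin n → A) → A}

theorem IsCompatible.isWalk (hE : IsCompatible t E) (k : ℕ) : IsCompatible t (IsWalk E k) := by
  induction k with
  | zero => intro u v h; exact congrArg t (funext h)
  | succ k ih =>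
    intro u v h
    choose c hc hw using h
    exact ⟨t c, hE _ _ hc, ih _ _ hw⟩

/-- If one of two adjacent generators `x`, `y` of an idempotent algebra lies on a closed walk of odd
length in a compatible symmetric digraph, then walks of all large lengths join it to each element. -/
theorem exists_forall_isWalk (ht : IsIdempotentOperation t) (hE : IsCompatible t E)
    (hs : ∀ ⦃a b⦄, E a b → E b a) {x y : A} (hgen : IsGeneratedBy t {x, y}) (hxy : E x y) {k : ℕ}
    (hk : IsWalk E (2 * k + 1) x x) (u : A) : ∃ N, ∀ m ≥ N, IsWalk E m x u := by
  have hx : ∀ m ≥ 2 * k, IsWalk E m x x := by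
    intro m hm
    rcases Nat.even_or_odd' m with ⟨c, rfl | rfl⟩
    · exact isWalk_bounce hs hxy c
    · have := hk.append (isWalk_bounce hs hxy (c - k))
      rwa [show 2 * k + 1 + 2 * (c - k) = 2 * c + 1 by omega] at this
  have hu : u ∈ generatedSubuniverse t {x, y} := by rw [hgen]; trivial
  refine hu {u | ∃ N, ∀ m ≥ N, IsWalk E m x u} ⟨?_, ?_⟩
  · rintro v (rfl | rfl)
    · exact ⟨_, hx⟩
    · refine ⟨2 * k + 1, fun m hm => ?_⟩
      have := (hx (m - 1) (by omega)).append (isWalk_one hxy)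
      rwa [Nat.sub_add_cancel (by omega)] at this
  -- Closure under `t`: apply it to `n` walks of a common length starting at `x`; idempotence brings
  -- the starting point back to `x`.
  · intro a ha
    choose N hN using ha
    refine ⟨Finset.univ.sup N, fun m hm => ?_⟩
    have := hE.isWalk m (fun _ => x) a
      (fun i => hN i m ((Finset.le_sup (Finset.mem_univ i)).trans hm))
    rwa [ht x] at this

end Walks

/-! ### Tree labellings and loops -/

section Trees

variable {A : Type*} {n : ℕ} {t : (Fin n → A) → A}

theorem treeValue_congr {k : ℕ} {f g : List (Fin n) → A}
    (h : ∀ l, l.length = k → f l = g l) : treeValue t k f = treeValue t k g := by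
  induction k generalizing f g with
  | zero => exact h [] rfl
  | succ k ih =>
    exact ih fun l hl => congrArg t (funext fun j => h _ (by simp [hl]))

theorem treeValue_related {F : A → A → Prop} (hF : IsCompatible t F) {k : ℕ}
    {f g : List (Fin n) → A} (h : ∀ l, l.length = k → F (f l) (g l)) :
    F (treeValue t k f) (treeValue t k g) := by
  induction k generalizing f g with
  | zero => exact h [] rfl
  | succ k ih => exact ih fun l hl => hF _ _ fun j => h _ (by simp [hl])

theorem treeValue_succ_root (k : ℕ) (f : List (Fin n) → A) :
    treeValue t (k + 1) f = t (fun i => treeValue t k (fun l => f (l ++ [i]))) := by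
  induction k generalizing f with
  | zero => rfl
  | succ k ih => exact ih (fun l => t (fun j => f (j :: l)))

/-- Shifting the window through which a labelling sees a branch gives a loop. -/
theorem exists_loop_of_window (ht : IsIdempotentOperation t) {F : A → A → Prop}
    (hF : IsCompatible t F) {K : ℕ} {f : List (Fin n) → A}
    (hsync : ∀ l : List (Fin n), l.length = K → ∀ i, f (l ++ [i]) = f l)
    (h : ∀ l, F (f l) (t (fun j => f (j :: l)))) : ∃ u, F u u := by
  refine ⟨treeValue t K f, ?_⟩
  -- The last letter of an address is the choice at the root. Labels at depth `K + 1` ignore it, so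
  -- `t` at the root is applied to equal values.
  have e : treeValue t (K + 1) f = treeValue t K f := by
    rw [treeValue_succ_root]
    refine Eq.trans (congrArg t (funext fun i => ?_)) (ht _)
    exact treeValue_congr fun l hl => hsync l hl i
  have := treeValue_related hF (k := K) (f := f) (g := fun l => t (fun j => f (j :: l)))
    fun l _ => h l
  change F _ (treeValue t (K + 1) f) at this
  rwa [e] at this

theorem exists_loop_of_triangle (ht : IsIdempotentOperation t) {F : A → A → Prop}
    (hF : IsCompatible t F) (hsymm : ∀ ⦃a b⦄, F a b → F b a) {x y : A}
    (hexc : ∀ i, F x (t (Function.update (fun _ => y) i x)))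
    {s : ℕ} (hs : 1 ≤ s) {r : ℕ → A} (h0 : r 0 = x) (h1 : r 1 = y)
    (hr : ∀ i < s, F (r i) (r (i + 1))) {v w : A} (hv : F (r s) v) (hvw : F v w)
    (hw : F w (r s)) : ∃ u, F u u := by
  set c : ℕ → A := fun i => if i ≤ s then r i else if i = s + 1 then v else w with hc
  have hadj : ∀ i j, ColourAdj s i j → F (c i) (c j) := by
    rintro i j (⟨rfl, h⟩ | ⟨rfl, h⟩ | ⟨h2, h3, h4, h5, h6⟩)
    · simpa [hc, h, (Nat.le_succ i).trans h] using hr i h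
    · simpa [hc, h, (Nat.le_succ j).trans h] using hsymm (hr j h)
    · have c0 : c s = r s := by simp [hc]
      have c1 : c (s + 1) = v := by simp [hc]
      have c2 : c (s + 2) = w := by simp [hc]
      have hi : i = s ∨ i = s + 1 ∨ i = s + 2 := by omega
      have hj : j = s ∨ j = s + 1 ∨ j = s + 2 := by omega
      rcases hi with hi | hi | hi <;> rcases hj with hj | hj | hj <;>
        first
        | exact absurd (hi.trans hj.symm) h6
        | (rw [hi, hj]; simp only [c0, c1, c2]
           first
            | assumption
            | (apply hsymm; assumption))
  obtain ⟨K, hK⟩ := exists_colourState_append_eq n s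
  refine exists_loop_of_window ht hF (K := K) (f := fun l => c (colourState s l))
    (fun l hl i => by simp only [hK l hl.ge i]) fun l => ?_
  by_cases hall : ∀ j, ColourAdj s (colourState s l) (colourState s (j :: l))
  · rw [← ht (c (colourState s l))]
    exact hF _ _ fun j => hadj _ _ (by simpa only [ht] using hall j)
  -- The walk is parked at state `0`: the repeated letter `i` keeps it there, every other letter
  -- moves it to state `1`, so the children are labelled `y` except for `x` at `i`.
  · push Not at hall
    obtain ⟨i, hi⟩ := hall
    obtain ⟨hl0, hi0, hhead⟩ := (colourAdj_or_zero hs i l).resolve_left hi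
    have e : (fun j => c (colourState s (j :: l))) = Function.update (fun _ => y) i x := by
      funext j
      by_cases hj : j = i
      · subst hj; simp [hi0, hc, h0]
      · have hj1 : colourState s (j :: l) = 1 := by
          rcases colourAdj_or_zero hs j l with h | h
          · rw [hl0] at h; unfold ColourAdj at h; omega
          · rw [hhead] at h; exact absurd (Option.some.inj h.2.2).symm hj
        simp [hj, hj1, hc, hs, h1]
    rw [e, hl0]
    simpa [hc, h0] using hexc i

end Trees

/-! ### Odd closed walks and their shortening -/

section Descent

variable {A : Type*} {n : ℕ} {t : (Fin n → A) → A} {E : A → A → Prop} {x y : A}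

theorem exists_loop_of_odd_closed_walk (ht : IsIdempotentOperation t) (hE : IsCompatible t E)
    (hsymm : ∀ ⦃a b⦄, E a b → E b a) (hgen : IsGeneratedBy t {x, y}) (hxy : E x y)
    (hexc : ∀ i, E x (t (Function.update (fun _ => y) i x)))
    {k : ℕ} (hk : IsWalk E (2 * k + 1) x x) : ∃ u, E u u := by
  have key : ∀ m u, IsWalk E (2 * m + 1) u u → ∃ u, E u u := by
    intro m
    induction m with
    | zero =>
      rintro u ⟨v, hv, rfl⟩
      exact ⟨_, hv⟩
    | succ m ih =>
      rintro u ⟨v, huv, w, hvw, hwu⟩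
      obtain ⟨N, hN⟩ := exists_forall_isWalk ht hE hsymm hgen hxy hk u
      have hyu : IsWalk E (N + 1) y u := ⟨x, hsymm hxy, hN N le_rfl⟩
      obtain ⟨r, h0, h1, hr⟩ := hyu.exists_vertices
      have hsub : ∀ {a b}, E a b → IsWalk E (2 * m + 1) a b :=
        fun h => isWalk_of_edge hsymm h m
      -- The path is `x` followed by the walk of length `N + 1` from `y` to `u`, hence has length `N
      -- + 2`. The remaining walk of length `2m + 1` from `w` to `u` closes the triangle `u, v, w`.
      obtain ⟨z, hz⟩ := exists_loop_of_triangle ht (hE.isWalk (2 * m + 1))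
        (fun a b h => h.reverse hsymm) (fun i => hsub (hexc i)) (s := N + 2) (by omega)
        (r := fun i => Nat.casesOn i x r) rfl h0
        (fun i hi => by
          cases i with
          | zero => exact hsub (by simpa [h0] using hxy)
          | succ i => exact hsub (hr i (by omega)))
        (v := v) (w := w) (hsub (by simpa [h1] using huv)) (hsub hvw) (by simpa [h1] using hwu)
      exact ih z hz
  exact key k x hk

open Classical in
/-- The labelling obtained from the constant labelling `x` after `m` steps, where the step number
`i` exchanges `x` and `y` everywhere but in the position `i`. -/
noncomputable def flipLabel (n m : ℕ) (j : Fin n) : TaylorVar :=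
  if Even (m - if j.val < m then 1 else 0) then TaylorVar.x else TaylorVar.y

theorem exists_odd_closed_walk (ht : IsIdempotentOperation t) (hsymm : ∀ ⦃a b⦄, E a b → E b a)
    (hxy : E x y)
    (hflip : ∀ (i : Fin n) (f g : Fin n → TaylorVar), (∀ j ≠ i, f j ≠ g j) →
      E (t fun j => (f j).subst x y) (t fun j => (g j).subst x y)) :
    ∃ k, IsWalk E (2 * k + 1) x x := by
  have hwalk : ∀ m ≤ n, IsWalk E m x (t fun j => (flipLabel n m j).subst x y) := by
    intro m
    induction m with
    | zero => intro _; simp [IsWalk, flipLabel, TaylorVar.subst, ht x]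
    | succ m ih =>
      intro hm
      refine (ih (by omega)).append (isWalk_one (hflip ⟨m, hm⟩ _ _ fun j hj => ?_))
      have hj' : j.val ≠ m := fun h => hj (Fin.ext h)
      unfold flipLabel
      by_cases h : j.val < m
      · obtain ⟨c, rfl⟩ : ∃ c, m = c + 1 := ⟨m - 1, by omega⟩
        by_cases hc : Even c <;> simp [h, h.trans (Nat.lt_succ_self _), Nat.even_add_one, hc]
      · by_cases hc : Even m <;>
          simp [h, show ¬ j.val < m + 1 by omega, Nat.even_add_one, hc]
  have h := hwalk n le_rfl
  -- After all `n` flips every label has changed `n - 1` times: for odd `n` the walk is back at `x`,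
  -- for even `n` it is at `y` and one more edge closes it.
  rcases Nat.even_or_odd' n with ⟨c, hc | hc⟩
  · have e : (t fun j => (flipLabel n n j).subst x y) = y := by
      refine Eq.trans (congrArg t (funext fun j => ?_)) (ht y)
      have : ¬ Even (n - 1) := by rw [Nat.not_even_iff]; have := j.isLt; omega
      simp [flipLabel, j.isLt, this, TaylorVar.subst]
    rw [e, hc] at h
    exact ⟨c, h.append (isWalk_one (hsymm hxy))⟩
  · have e : (t fun j => (flipLabel n n j).subst x y) = x := by
      refine Eq.trans (congrArg t (funext fun j => ?_)) (ht x)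
      have : Even (n - 1) := by rw [Nat.even_iff]; omega
      simp [flipLabel, j.isLt, this, TaylorVar.subst]
    rw [e, hc] at h
    exact ⟨c, h⟩

end Descent

/-! ### The double loop -/

section DoubleLoop

variable {A B : Type*} {n : ℕ}

theorem subset_generatedSubuniverse (t : (Fin n → A) → A) (X : Set A) :
    X ⊆ generatedSubuniverse t X :=
  fun _ ha _ hS => hS.1 ha

theorem isSubuniverse_generatedSubuniverse (t : (Fin n → A) → A) (X : Set A) :
    IsSubuniverse t (generatedSubuniverse t X) :=
  fun a ha S hS => hS.2 a fun i => ha i S hS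

theorem swap_mem_generatedSubuniverse {tA : (Fin n → A) → A} {tB : (Fin n → B) → B}
    {xA yA : A} {xB yB : B} {a₀ a₁ : A} {b₀ b₁ : B}
    (h : (a₀, a₁, b₀, b₁) ∈ generatedSubuniverse (quadrupleOperation tA tB)
      (doubleLoopGenerators xA yA xB yB)) :
    (a₁, a₀, b₁, b₀) ∈ generatedSubuniverse (quadrupleOperation tA tB)
      (doubleLoopGenerators xA yA xB yB) := by
  refine h {q | (q.2.1, q.1, q.2.2.2, q.2.2.1) ∈ generatedSubuniverse (quadrupleOperation tA tB)
      (doubleLoopGenerators xA yA xB yB)} ⟨?_, fun q hq => ?_⟩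
  · rintro _ ⟨c₀, c₁, d₀, d₁, hne, rfl⟩
    exact subset_generatedSubuniverse _ _
      ⟨c₁, c₀, d₁, d₀, hne.imp Ne.symm Ne.symm, rfl⟩
  · exact isSubuniverse_generatedSubuniverse (quadrupleOperation tA tB) _ _ hq

end DoubleLoop

theorem mainTheorem3 {A : Type*} {B : Type*} (n : ℕ)
    (tA : (Fin n → A) → A) (tB : (Fin n → B) → B)
    (xA yA : A) (xB yB : B)
    (hA_gen : IsGeneratedBy tA {xA, yA})
    (hA_idem : IsIdempotentOperation tA)
    (hB_gen : IsGeneratedBy tB {xB, yB})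
    (hB_taylor : ∃ T : QuasiTaylorSystem n, T.SatisfiedLocallyOn tB {xB, yB}) :
    ∃ (a : A) (b : B), (a, a, b, b) ∈
      generatedSubuniverse (quadrupleOperation tA tB) (doubleLoopGenerators xA yA xB yB) := by
  obtain ⟨T, hT⟩ := hB_taylor
  set Q := generatedSubuniverse (quadrupleOperation tA tB) (doubleLoopGenerators xA yA xB yB)
    with hQ
  have hQt : IsSubuniverse (quadrupleOperation tA tB) Q :=
    isSubuniverse_generatedSubuniverse _ _
  have hgen : doubleLoopGenerators xA yA xB yB ⊆ Q := subset_generatedSubuniverse _ _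
  set E : A → A → Prop := fun a₀ a₁ => ∃ b, (a₀, a₁, b, b) ∈ Q with hEdef
  have hsymm : ∀ ⦃a b⦄, E a b → E b a := fun a₀ a₁ ⟨b, hb⟩ => ⟨b, swap_mem_generatedSubuniverse hb⟩
  have hE : IsCompatible tA E := by
    intro u v h
    choose b hb using h
    exact ⟨tB b, hQt (fun i => (u i, v i, b i, b i)) hb⟩
  have hxy : E xA yA := ⟨xB, hgen ⟨.x, .y, .x, .x, Or.inl (by simp), rfl⟩⟩
  have hflip : ∀ (i : Fin n) (f g : Fin n → TaylorVar), (∀ j ≠ i, f j ≠ g j) →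
      E (tA fun j => (f j).subst xA yA) (tA fun j => (g j).subst xA yA) := by
    intro i f g hfg
    -- The two sides of equation `i` fill the `B`-coordinates: they differ at position `i`, where
    -- `f` and `g` may agree, so every column is a generator, and the equation makes the two results
    -- equal.
    refine ⟨tB fun j => (T.lhs i j).subst xB yB, ?_⟩
    have h := hQt (fun j => ((f j).subst xA yA, (g j).subst xA yA,
      (T.lhs i j).subst xB yB, (T.rhs i j).subst xB yB)) fun j => hgen ⟨_, _, _, _, ?_, rfl⟩
    · have e := hT i xB (by simp) yB (by simp)
      simpa only [quadrupleOperation, ← e] using h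
    · by_cases hj : j = i
      · subst hj; right; simp [T.lhs_diag, T.rhs_diag]
      · exact Or.inl (hfg j hj)
  obtain ⟨k, hk⟩ := exists_odd_closed_walk hA_idem hsymm hxy hflip
  refine exists_loop_of_odd_closed_walk hA_idem hE hsymm hA_gen hxy (fun i => ?_) hk
  -- The constant labelling `x` and the labelling with `x` only at `i` differ exactly off `i`.
  have h := hflip i (fun _ => .x) (Function.update (fun _ => .y) i .x) fun j hj => by simp [hj]
  have e : (fun j => (Function.update (fun _ => TaylorVar.y) i TaylorVar.x j).subst xA yA) =
      Function.update (fun _ => yA) i xA := by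
    funext j
    by_cases hj : j = i
    · subst hj; simp [TaylorVar.subst]
    · simp [hj, TaylorVar.subst]
  rw [e] at h
  simpa only [TaylorVar.subst, hA_idem xA] using h
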